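/- Let $k$ be a field of characteristic zero (for instance $k=\mathbb{C}$), let $X$ be a smooth scheme over $k$ (for instance a smooth variety), and let $\omega\in H^0(X,\Omega^1_{X/k})$ be an integrable $1$-form, i.e. $\omega\wedge d\omega=0$. For a point $x\in X$ let $\mathcal{J}(\omega)_x\subseteq\mathcal{O}_{X,x}$ be the stalk of the ideal sheaf of the singular scheme (zero scheme) $\mathrm{sing}(\omega)$ of $\omega$, i.e. the ideal $\{\varphi(\omega_x) : \varphi\in\mathrm{Hom}_{\mathcal{O}_{X,x}}(\Omega^1_{X,x},\mathcal{O}_{X,x})\}$ generated by the coefficients of $\omega_x$ in a basis of $\Omega^1_{X,x}$. Let $p\in\mathrm{sing}(\omega)$ be a point, and suppose that $\mathrm{sing}(\omega)$ has codimension at least $2$ at $p$ (i.e. $\mathcal{J}(\omega)_p$ has height at least $2$), that $\mathcal{J}(\omega)_p$ is a radical ideal, and that $(d\omega)_p\in\mathcal{J}(\omega)_p\cdot\Omega^2_{X,p}$. Then there is a formal $1$-form $\eta\in\widehat{\Omega^1_{X,p}}$ (the completion with respect to the maximal ideal of $\mathcal{O}_{X,p}$) such that $$d\omega=\omega\wedge\eta\quad\text{in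 }\widehat{\Omega^2_{X,p}}.$$ -/

import Mathlib

open CategoryTheory AlgebraicGeometry Opposite

universe u

noncomputable section

/-! ### Differential forms on a commutative algebra -/

namespace KForm

section Algebra

variable (k : Type u) [CommRing k] (A : Type u) [CommRing A] [Algebra k A]

/-- The module `Ω²_{A/k}` of Kähler 2-forms. -/
abbrev Omega2 : Type u := ⋀[A]^2 (Ω[A⁄k])

variable {k A}

/-- The linear map `η ↦ ω ∧ η` from 1-forms to 2-forms. -/
def wedge (ω : Ω[A⁄k]) : Ω[A⁄k] →ₗ[A] Omega2 k A where
  toFun η := exteriorPower.ιMulti A 2 ![ω, η]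
  map_add' η η' := by
    apply Subtype.ext
    simp [ExteriorAlgebra.ιMulti_apply, mul_add]
  map_smul' c η := by
    apply Subtype.ext
    simp [ExteriorAlgebra.ιMulti_apply]

theorem wedge_apply (ω η : Ω[A⁄k]) :
    wedge ω η = exteriorPower.ιMulti A 2 ![ω, η] := rfl

theorem wedge_coe (ω η : Ω[A⁄k]) :
    (wedge ω η : ExteriorAlgebra A (Ω[A⁄k])) = ExteriorAlgebra.ι A ω * ExteriorAlgebra.ι A η := by
  simp [wedge_apply, ExteriorAlgebra.ιMulti_apply]

theorem wedge_add_left (ω ω' η : Ω[A⁄k]) : wedge (ω + ω') η = wedge ω η + wedge ω' η := by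
  apply Subtype.ext
  simp [wedge_coe, add_mul]

theorem wedge_smul_left (a : A) (ω η : Ω[A⁄k]) : wedge (a • ω) η = a • wedge ω η := by
  apply Subtype.ext
  simp [wedge_coe]

theorem wedge_self (ω : Ω[A⁄k]) : wedge ω ω = 0 := by
  apply Subtype.ext
  simp [wedge_coe]

theorem wedge_swap (ω η : Ω[A⁄k]) : wedge ω η = - wedge η ω := by
  have h := wedge_self (ω + η)
  rw [map_add, wedge_add_left, wedge_add_left, wedge_self, wedge_self] at h
  rw [eq_neg_iff_add_eq_zero]
  simpa [add_comm] using h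

variable (k A)

/-- The additive map on the free module on symbols `db` given by `a db ↦ da ∧ db`. -/
def dFree : (A →₀ A) →+ Omega2 k A :=
  Finsupp.liftAddHom fun b =>
    { toFun := fun a => wedge (KaehlerDifferential.D k A a) (KaehlerDifferential.D k A b)
      map_zero' := by
        apply Subtype.ext
        simp [wedge_coe]
      map_add' := fun a a' => by rw [map_add, wedge_add_left] }

@[simp] theorem dFree_single (a b : A) :
    dFree k A (Finsupp.single b a) =
      wedge (KaehlerDifferential.D k A a) (KaehlerDifferential.D k A b) := by
  exact Finsupp.liftAddHom_apply_single _ b a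

theorem dFree_kerTotal (x : A →₀ A) (hx : x ∈ KaehlerDifferential.kerTotal k A) :
    dFree k A x = 0 := by
  unfold KaehlerDifferential.kerTotal at hx
  induction hx using Submodule.closure_induction with
  | zero => simp
  | add x y _ _ hx hy => rw [map_add, hx, hy, add_zero]
  | smul_mem a x hx =>
    rcases hx with (⟨⟨x, y⟩, rfl⟩ | ⟨⟨x, y⟩, rfl⟩) | ⟨r, rfl⟩
    · simp [smul_sub, smul_add]
    · simp only [smul_add, smul_sub, Finsupp.smul_single, smul_eq_mul, map_add, map_sub,
        dFree_single, mul_one, Derivation.leibniz, map_smul, wedge_add_left, wedge_smul_left]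
      rw [wedge_swap (KaehlerDifferential.D k A y) (KaehlerDifferential.D k A x)]
      module
    · simp

/-- The exterior derivative `d : Ω¹_{A/k} → Ω²_{A/k}`, determined by `d(a db) = da ∧ db`. -/
def extDeriv : Ω[A⁄k] →+ Omega2 k A :=
  (QuotientAddGroup.lift (KaehlerDifferential.kerTotal k A).toAddSubgroup (dFree k A)
    (fun x hx => dFree_kerTotal k A x hx)).comp
    (KaehlerDifferential.quotKerTotalEquiv k A).symm.toAddEquiv.toAddMonoidHom

theorem extDeriv_smul_D (a b : A) :
    extDeriv k A (a • KaehlerDifferential.D k A b) =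
      wedge (KaehlerDifferential.D k A a) (KaehlerDifferential.D k A b) := by
  have h : (KaehlerDifferential.quotKerTotalEquiv k A).symm (a • KaehlerDifferential.D k A b) =
      (KaehlerDifferential.kerTotal k A).mkQ (Finsupp.single b a) := by
    rw [LinearEquiv.symm_apply_eq]
    simp [KaehlerDifferential.quotKerTotalEquiv]
  have h' : extDeriv k A (a • KaehlerDifferential.D k A b) =
      QuotientAddGroup.lift (KaehlerDifferential.kerTotal k A).toAddSubgroup (dFree k A)
        (fun x hx => dFree_kerTotal k A x hx)
        ((KaehlerDifferential.quotKerTotalEquiv k A).symm (a • KaehlerDifferential.D k A b)) := rfl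
  rw [h', h]
  exact dFree_single k A a b

variable {k A}

/-- The ideal of the zero scheme of a 1-form: the image of the contraction with `ω`, that is
`{φ(ω) | φ : Ω¹ → A linear}`.  When `Ω¹` is free this is generated by the coefficients of `ω`. -/
def coeffIdeal (ω : Ω[A⁄k]) : Ideal A :=
  LinearMap.range (Module.Dual.eval A (Ω[A⁄k]) ω)

/-- `ω ∧ dω`, as an element of the exterior algebra of `Ω¹` (homogeneous of degree 3). -/
def wedgeD (ω : Ω[A⁄k]) : ExteriorAlgebra A (Ω[A⁄k]) :=
  ExteriorAlgebra.ι A ω * (extDeriv k A ω : ExteriorAlgebra A (Ω[A⁄k]))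

/-- Functoriality of Kähler 1-forms: `a db ↦ φ(a) dφ(b)`. -/
def mapForm {B : Type u} [CommRing B] [Algebra k B] (φ : A →ₐ[k] B) : Ω[A⁄k] →+ Ω[B⁄k] :=
  letI : Algebra A B := φ.toRingHom.toAlgebra
  haveI : IsScalarTower k A B := .of_algebraMap_eq fun r => (φ.commutes r).symm
  (KaehlerDifferential.map k k A B).toAddMonoidHom

theorem mapForm_smul_D {B : Type u} [CommRing B] [Algebra k B] (φ : A →ₐ[k] B) (a b : A) :
    mapForm φ (a • KaehlerDifferential.D k A b) = φ a • KaehlerDifferential.D k B (φ b) := by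
  let _ : Algebra A B := φ.toRingHom.toAlgebra
  have _ : IsScalarTower k A B := .of_algebraMap_eq fun r => (φ.commutes r).symm
  change KaehlerDifferential.map k k A B (a • KaehlerDifferential.D k A b) = _
  rw [map_smul, KaehlerDifferential.map_D, algebra_compatible_smul B a]
  rfl

theorem oneForm_induction {P : Ω[A⁄k] → Prop} (h0 : P 0)
    (hD : ∀ a b : A, P (a • KaehlerDifferential.D k A b))
    (hadd : ∀ x y, P x → P y → P (x + y)) (ω : Ω[A⁄k]) : P ω := by
  have hω : ω ∈ Submodule.span A (Set.range (KaehlerDifferential.D k A)) := by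
    rw [KaehlerDifferential.span_range_derivation]; trivial
  induction hω using Submodule.closure_induction with
  | zero => exact h0
  | add x y _ _ hx hy => exact hadd x y hx hy
  | smul_mem a x hx => obtain ⟨b, rfl⟩ := hx; exact hD a b

theorem mapForm_comp {B C : Type u} [CommRing B] [Algebra k B] [CommRing C] [Algebra k C]
    (φ : A →ₐ[k] B) (ψ : B →ₐ[k] C) (ω : Ω[A⁄k]) :
    mapForm ψ (mapForm φ ω) = mapForm (ψ.comp φ) ω := by
  induction ω using oneForm_induction with
  | h0 => simp
  | hD a b => simp [mapForm_smul_D]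
  | hadd x y hx hy => simp [hx, hy]

end Algebra

end KForm

/-! ### 1-forms on a scheme over a field -/

namespace SchemeForm

variable (k : Type u) [Field k] (X : Scheme.{u}) [X.Over (Spec (.of k))]

/-- The structure map `k → Γ(X, ⊤)`. -/
def structureHom : CommRingCat.of k ⟶ Γ(X, ⊤) :=
  (Scheme.ΓSpecIso (.of k)).inv ≫ (X ↘ Spec (.of k)).appTop

instance algebraSections (U : X.Opens) : Algebra k Γ(X, U) :=
  (structureHom k X ≫ X.presheaf.map (homOfLE le_top).op).hom.toAlgebra

instance algebraStalk (x : X) : Algebra k (X.presheaf.stalk x) :=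
  (structureHom k X ≫ X.presheaf.germ ⊤ x trivial).hom.toAlgebra

variable {X}

/-- Restriction of functions, as a homomorphism of `k`-algebras. -/
def resHom {U V : X.Opens} (h : U ≤ V) : Γ(X, V) →ₐ[k] Γ(X, U) where
  __ := (X.presheaf.map (homOfLE h).op).hom
  commutes' r := by
    change ((structureHom k X ≫ X.presheaf.map _) ≫ X.presheaf.map _).hom r = _
    rw [Category.assoc, ← Functor.map_comp]
    rfl

/-- The germ of a function at a point, as a homomorphism of `k`-algebras. -/
def germHom (U : X.Opens) (x : X) (hx : x ∈ U) : Γ(X, U) →ₐ[k] X.presheaf.stalk x where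
  __ := (X.presheaf.germ U x hx).hom
  commutes' r := by
    change ((structureHom k X ≫ X.presheaf.map _) ≫ X.presheaf.germ U x hx).hom r = _
    rw [Category.assoc, X.presheaf.germ_res]
    rfl

theorem germHom_comp_resHom {U V : X.Opens} (h : U ≤ V) (x : X) (hx : x ∈ U) :
    (germHom k U x hx).comp (resHom k h) = germHom k V x (h hx) := by
  ext s
  exact X.presheaf.germ_res_apply (homOfLE h) x hx s

variable (X)

/-- A 1-form on `X`, i.e. a global section of the quasi-coherent sheaf `Ω¹_{X/k}`: a family of
Kähler 1-forms on the affine open subsets of `X` which is compatible with restriction. -/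
structure OneForm where
  /-- The value on an affine open subset. -/
  val : ∀ U : X.affineOpens, Ω[Γ(X, (U : X.Opens))⁄k]
  /-- Compatibility with restriction. -/
  compat : ∀ (U V : X.affineOpens) (h : (U : X.Opens) ≤ V),
    KForm.mapForm (resHom k h) (val V) = val U

variable {X}

theorem exists_affineOpens_mem (x : X) : ∃ U : X.affineOpens, x ∈ (U : X.Opens) := by
  obtain ⟨U, hU, hx, -⟩ := X.isBasis_affineOpens.exists_subset_of_mem_open
    (Set.mem_univ x) isOpen_univ
  obtain ⟨V, hV, rfl⟩ := hU
  exact ⟨⟨V, hV⟩, hx⟩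

variable {k}

namespace OneForm

/-- The germ `ω_x ∈ Ω¹_{X,x}`; here `Ω¹_{X,x}` is the module of Kähler differentials of the local
ring `O_{X,x}` over `k`.  It does not depend on the affine neighbourhood chosen. -/
def germ (ω : OneForm k X) (x : X) : Ω[X.presheaf.stalk x⁄k] :=
  KForm.mapForm (germHom k _ x (exists_affineOpens_mem x).choose_spec)
    (ω.val (exists_affineOpens_mem x).choose)

theorem germ_eq (ω : OneForm k X) (x : X) (U : X.affineOpens) (hx : x ∈ (U : X.Opens)) :
    ω.germ x = KForm.mapForm (germHom k U x hx) (ω.val U) := by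
  set V := (exists_affineOpens_mem x).choose with hV
  have hxV : x ∈ (V : X.Opens) := (exists_affineOpens_mem x).choose_spec
  obtain ⟨W', ⟨W, hW, rfl⟩, hxW, hsub⟩ := X.isBasis_affineOpens.exists_subset_of_mem_open
    (show x ∈ (((U : X.Opens) ⊓ V : X.Opens) : Set X) from ⟨hx, hxV⟩)
    ((U : X.Opens) ⊓ V : X.Opens).isOpen
  have hWU : W ≤ (U : X.Opens) := fun y hy => (hsub hy).1
  have hWV : W ≤ (V : X.Opens) := fun y hy => (hsub hy).2
  change KForm.mapForm (germHom k V x hxV) (ω.val V) = _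
  rw [← germHom_comp_resHom k hWU x hxW, ← germHom_comp_resHom k hWV x hxW,
    ← KForm.mapForm_comp, ← KForm.mapForm_comp, ω.compat ⟨W, hW⟩ U hWU, ω.compat ⟨W, hW⟩ V hWV]

/-- The Frobenius condition `ω ∧ dω = 0` (a section of `Ω³` vanishes iff all its germs do). -/
def Integrable (ω : OneForm k X) : Prop := ∀ x : X, KForm.wedgeD (ω.germ x) = 0

/-- The set of points where `ω` vanishes, i.e. where its germ lies in `𝔪_x Ω¹_{X,x}`. -/
def sing (ω : OneForm k X) : Set X :=
  {x | ω.germ x ∈ IsLocalRing.maximalIdeal (X.presheaf.stalk x) •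
    (⊤ : Submodule (X.presheaf.stalk x) (Ω[X.presheaf.stalk x⁄k]))}

/-- The stalk at `x` of the ideal sheaf of the singular scheme of `ω`. -/
def singIdeal (ω : OneForm k X) (x : X) : Ideal (X.presheaf.stalk x) :=
  KForm.coeffIdeal (ω.germ x)

/-- The germ at `x` of the 2-form `dω`. -/
def dGerm (ω : OneForm k X) (x : X) : KForm.Omega2 k (X.presheaf.stalk x) :=
  KForm.extDeriv k _ (ω.germ x)

end OneForm

variable (k)

/-- Formal 1-forms at `x`: the `𝔪_x`-adic completion of `Ω¹_{X,x}`. -/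
abbrev FormalOneForm (x : X) : Type u :=
  AdicCompletion (IsLocalRing.maximalIdeal (X.presheaf.stalk x)) (Ω[X.presheaf.stalk x⁄k])

/-- Formal 2-forms at `x`: the `𝔪_x`-adic completion of `Ω²_{X,x}`. -/
abbrev FormalTwoForm (x : X) : Type u :=
  AdicCompletion (IsLocalRing.maximalIdeal (X.presheaf.stalk x))
    (KForm.Omega2 k (X.presheaf.stalk x))

variable {k}

namespace OneForm

/-- The wedge product `η ↦ ω ∧ η` on formal forms at `x`: the completion of the wedge product
with the germ `ω_x`. -/
def formalWedge (ω : OneForm k X) (x : X) (η : FormalOneForm k x) : FormalTwoForm k x :=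
  AdicCompletion.map _ (KForm.wedge (ω.germ x)) η

/-- The formal 2-form at `x` induced by `dω`. -/
def formalD (ω : OneForm k X) (x : X) : FormalTwoForm k x :=
  AdicCompletion.of _ _ (ω.dGerm x)

end OneForm

end SchemeForm

end

/-! ### Linear equations over a Noetherian ring -/

section LocalGlobal

variable {A : Type*} [CommRing A]

/-! In a basis of `Ω¹` at `p`, let `a` be the coefficient vector of `ω`, `J` the ideal it generates
and `θ = dω`. Then `θ` has coefficients in `J` and `a ∧ θ = 0`, and the equation `θ = a ∧ ξ` is
already solvable over the local ring itself; completion plays no role beyond mapping this `ξ` to a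
formal form.

Suppose it is not solvable. An associated prime of the cyclic module generated by `θ` modulo the
image of `a ∧ -` is the exact annihilator `P` of some multiple `s θ`. Over `A_P` every element of
the maximal ideal `m` carries `s θ` into the image, and it suffices to show that `s θ` then lies in
the image (`Matrix.exists_mulVec_eq_of_localization`). If some `a i` is a unit, contraction solves
the equation. Otherwise `J ≤ m`, and `m` is generated by a weakly regular sequence of length at
least two, because smooth algebras are locally étale over affine space
(`LocallyGeneratedByRegular.of_smooth`).

If the length is two, radicality and height force `J = m = (x, y)`. Contracting the cocycle `θ` then
yields explicit primitives of `x θ` and `y θ`, and their compatibility follows from `θ` having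
coefficients in `J`. If the length is at least three, primitives of `x θ`, `y θ`, `z θ` are given by
the choice of `P`, and regularity of `x, y, z` makes them compatible. In both cases
`exists_wedge_eq_of_regular` divides by `x`. The same reduction gives exactness of `a ∧ -` in
degrees zero and one, which the second case needs. -/

theorem Submodule.exists_prime_forall_mem_iff_smul_mem [IsNoetherianRing A]
    {M : Type*} [AddCommGroup M] [Module A M] (N : Submodule A M) {x : M} (hx : x ∉ N) :
    ∃ (P : Ideal A) (s : A), P.IsPrime ∧ ∀ r, r ∈ P ↔ r • s • x ∈ N := by
  have hx' : (⟨N.mkQ x, Submodule.mem_span_singleton_self _⟩ :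
      Submodule.span A {N.mkQ x}) ≠ 0 := by
    intro h
    exact hx ((Submodule.Quotient.mk_eq_zero N).mp (congrArg Subtype.val h))
  -- Using the cyclic module on the class of `x`, not the whole quotient, makes the annihilated
  -- element a multiple `s • x`.
  obtain ⟨P, hP, -⟩ := exists_le_isAssociatedPrime_of_isNoetherianRing A _ hx'
  obtain ⟨hP, ⟨y, hyx⟩, rfl⟩ := isAssociatedPrime_iff.mp hP
  obtain ⟨s, rfl⟩ := Submodule.mem_span_singleton.mp hyx
  refine ⟨_, s, hP, fun r => ?_⟩
  rw [Submodule.mem_colon_singleton, Submodule.mem_bot, ← Submodule.Quotient.mk_eq_zero N,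
    ← Subtype.coe_inj]
  rfl

/-- To solve a system of linear equations over a Noetherian ring, it suffices to solve it over
each localization at a prime `P` after all multiples of the right hand side by elements of the
maximal ideal are known to be solvable. -/
theorem Matrix.exists_mulVec_eq_of_localization [IsNoetherianRing A] {τ κ : Type*} [Fintype κ]
    [Finite τ] (W : Matrix τ κ A) (θ : τ → A)
    (h : ∀ (P : Ideal A) [P.IsPrime] (s : A),
      (∀ r ∈ IsLocalRing.maximalIdeal (Localization.AtPrime P),
        ∃ v, ∀ i, r * algebraMap A _ (s * θ i) =
          ((W.map (algebraMap A (Localization.AtPrime P))).mulVec v) i) →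
      ∃ v, ∀ i, algebraMap A _ (s * θ i) =
        ((W.map (algebraMap A (Localization.AtPrime P))).mulVec v) i) :
    ∃ v, ∀ i, θ i = W.mulVec v i := by
  by_contra hcon
  have hθ : θ ∉ LinearMap.range W.mulVecLin := by
    rintro ⟨v, rfl⟩
    exact hcon ⟨v, fun i => rfl⟩
  obtain ⟨P, s, hP, hPs⟩ := Submodule.exists_prime_forall_mem_iff_smul_mem _ hθ
  obtain ⟨v, hv⟩ := h P s (by
    intro r hr
    obtain ⟨r, t, rfl⟩ := IsLocalization.exists_mk'_eq P.primeCompl r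
    have hrP : r ∈ P := by
      rwa [IsLocalization.AtPrime.mk'_mem_maximal_iff _ P] at hr
    obtain ⟨v, hv⟩ := (hPs r).mp hrP
    refine ⟨fun j => IsLocalization.mk' _ (v j) t, fun i => ?_⟩
    have hi := congrArg (algebraMap A (Localization.AtPrime P)) (congrFun hv i)
    simp only [Matrix.mulVecLin_apply, Matrix.mulVec, dotProduct, map_sum, map_mul, Pi.smul_apply,
      smul_eq_mul] at hi
    simp only [Matrix.mulVec, dotProduct, Matrix.map_apply, IsLocalization.mk'_eq_mul_mk'_one r,
      IsLocalization.mk'_eq_mul_mk'_one (v _), map_mul]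
    simp only [← mul_assoc, ← Finset.sum_mul, hi]
    ring)
  -- `t` clears the denominators of `v`, and `u i` turns the `i`-th equation over `A_P` into one
  -- over `A`. The product `U * t` then lies in `P`, although all its factors avoid `P`.
  obtain ⟨t, ht⟩ := IsLocalization.exist_integer_multiples_of_finite P.primeCompl v
  choose v' hv' using ht
  have hzero : ∀ i, ∃ u : P.primeCompl, u * (t * (s * θ i)) = u * W.mulVec v' i := by
    intro i
    rw [← IsLocalization.eq_iff_exists P.primeCompl (Localization.AtPrime P), map_mul, hv i]
    simp only [Matrix.mulVec, dotProduct, Matrix.map_apply, map_sum, map_mul, Finset.mul_sum, hv',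
      Algebra.smul_def]
    exact Finset.sum_congr rfl fun j _ => by ring
  choose u hu using hzero
  cases nonempty_fintype τ
  set U : P.primeCompl := ∏ i, u i with hU
  have hmem : (U * t : P.primeCompl).1 ∈ P := by
    rw [hPs]
    refine ⟨(U : A) • v', funext fun i => ?_⟩
    obtain ⟨w, hw⟩ : u i ∣ U := Finset.dvd_prod_of_mem _ (Finset.mem_univ i)
    simp only [Matrix.mulVecLin_apply, Matrix.mulVec_smul, Pi.smul_apply, smul_eq_mul, hw,
      Submonoid.coe_mul]
    linear_combination -(w : A) * hu i
  exact (U * t : P.primeCompl).2 hmem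

end LocalGlobal

/-! ### Koszul-type equations over a ring with a regular sequence -/

section Koszul

variable {A : Type*} [CommRing A] {ι : Type*}

/-- A 2-form `θ` is divisible by the 1-form `a` as soon as `x θ = a ∧ η` and `y θ = a ∧ ζ` for a
regular sequence `x, y` such that `y η - x ζ ∈ (x, y) a`. -/
theorem exists_wedge_eq_of_regular {x y : A} (hx : ∀ r, x * r = 0 → r = 0)
    (hy : ∀ r s, y * r = x * s → ∃ t, r = x * t) (a η ζ : ι → A) (θ : ι → ι → A) (u v : A)
    (hη : ∀ i j, x * θ i j = a i * η j - a j * η i)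
    (hc : ∀ i, y * η i - x * ζ i = (x * u - y * v) * a i) :
    ∃ ξ : ι → A, ∀ i j, θ i j = a i * ξ j - a j * ξ i := by
  have h : ∀ i, ∃ t, η i + v * a i = x * t := fun i =>
    hy _ (ζ i + u * a i) (by linear_combination hc i)
  choose ξ hξ using h
  -- Adding `v a` to `η` does not change `a ∧ η`, so `x θ = x (a ∧ ξ)`.
  refine ⟨ξ, fun i j => sub_eq_zero.mp (hx _ ?_)⟩
  linear_combination hη i j - a j * hξ i + a i * hξ j

/-- The difference `y η_x - x η_y` is killed by `a ∧ -`, hence is `c a`. Comparing the three such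
differences puts `z c` in `(x, y)`, so `c` itself lies in `(x, y)` by regularity of `z`. -/
theorem exists_wedge_eq_of_regular_of_regular {x y z : A} (hx : ∀ r, x * r = 0 → r = 0)
    (hy : ∀ r s, y * r = x * s → ∃ t, r = x * t)
    (hz : ∀ r s t, z * r = x * s + y * t → ∃ s t, r = x * s + y * t)
    (a : ι → A) (h0 : ∀ c, (∀ i, c * a i = 0) → c = 0)
    (h1 : ∀ η : ι → A, (∀ i j, a i * η j - a j * η i = 0) → ∃ c, ∀ i, η i = c * a i)
    (θ : ι → ι → A) (η : A → ι → A)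
    (hη : ∀ r ∈ ({x, y, z} : Set A), ∀ i j, r * θ i j = a i * η r j - a j * η r i) :
    ∃ ξ : ι → A, ∀ i j, θ i j = a i * ξ j - a j * ξ i := by
  have hc : ∀ r ∈ ({x, y, z} : Set A), ∀ s ∈ ({x, y, z} : Set A),
      ∃ c, ∀ i, s * η r i - r * η s i = c * a i := fun r hr s hs =>
    h1 (fun i => s * η r i - r * η s i) fun i j => by
      linear_combination r * hη s hs i j - s * hη r hr i j
  obtain ⟨c, hc₁⟩ := hc x (by simp) y (by simp)
  obtain ⟨c', hc₂⟩ := hc x (by simp) z (by simp)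
  obtain ⟨c'', hc₃⟩ := hc y (by simp) z (by simp)
  have hzc : z * c = x * (-c'') + y * c' := by
    rw [← sub_eq_zero]
    refine h0 _ fun i => ?_
    linear_combination -z * hc₁ i + y * hc₂ i - x * hc₃ i
  obtain ⟨u, v, huv⟩ := hz _ _ _ hzc
  refine exists_wedge_eq_of_regular hx hy a (η x) (η y) θ u (-v) (hη x (by simp)) fun i => ?_
  rw [hc₁, huv]
  ring

/-- Contracting `a ∧ θ = 0` with `c` and `d` gives primitives of `x θ` and `y θ`. Contracting once
more shows that they are compatible up to `a` times combinations of `x`, `y` and `θ(c, d)`, and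
`θ(c, d)` lies in `(x, y)`. -/
theorem exists_wedge_eq_of_regular_of_mem [Fintype ι] {x y : A} (hx : ∀ r, x * r = 0 → r = 0)
    (hy : ∀ r s, y * r = x * s → ∃ t, r = x * t) (a c d : ι → A)
    (hc : ∑ i, c i * a i = x) (hd : ∑ i, d i * a i = y) (θ : ι → ι → A)
    (hθ : ∀ i j, θ i j ∈ Ideal.span {x, y})
    (hcoc : ∀ i j k, a i * θ j k - a j * θ i k + a k * θ i j = 0) :
    ∃ ξ : ι → A, ∀ i j, θ i j = a i * ξ j - a j * ξ i := by
  have key : ∀ (e : ι → A) (j k : ι), (∑ i, e i * a i) * θ j k =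
      a j * (∑ i, e i * θ i k) - a k * (∑ i, e i * θ i j) := by
    intro e j k
    rw [Finset.sum_mul, Finset.mul_sum, Finset.mul_sum, ← Finset.sum_sub_distrib]
    exact Finset.sum_congr rfl fun i _ => by linear_combination e i * hcoc i j k
  have hmem : ∑ j, c j * (∑ i, d i * θ i j) ∈ Ideal.span {x, y} :=
    Ideal.sum_mem _ fun j _ => Ideal.mul_mem_left _ _ <| Ideal.sum_mem _ fun i _ =>
      Ideal.mul_mem_left _ _ (hθ i j)
  obtain ⟨u, v, huv⟩ := Ideal.mem_span_pair.mp hmem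
  refine exists_wedge_eq_of_regular hx hy a (fun k => ∑ i, c i * θ i k)
    (fun k => ∑ i, d i * θ i k) θ (-u) v (fun j k => ?_) fun k => ?_
  · rw [← hc, key]
  · have h : ∑ j, c j * (y * θ j k) = ∑ j, c j * (a j * (∑ i, d i * θ i k) -
        a k * (∑ i, d i * θ i j)) :=
      Finset.sum_congr rfl fun j _ => by rw [← hd, key]
    simp only [mul_sub, Finset.sum_sub_distrib, ← mul_assoc, ← Finset.sum_mul, hc] at h
    have h₁ : ∑ j, c j * (y * θ j k) = y * ∑ j, c j * θ j k := by
      rw [Finset.mul_sum]; exact Finset.sum_congr rfl fun j _ => by ring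
    have h₂ : ∑ j, c j * a k * (∑ i, d i * θ i j) = a k * ∑ j, c j * (∑ i, d i * θ i j) := by
      rw [Finset.mul_sum]; exact Finset.sum_congr rfl fun j _ => by ring
    simp only [← mul_assoc] at h₁
    rw [h₂, h₁, ← huv] at h
    linear_combination h

end Koszul

/-! ### Rings whose local rings have maximal ideals generated by regular sequences -/

section RegularSequences

open IsLocalRing Polynomial RingTheory.Sequence

/-- The ideal is generated by a weakly regular sequence. -/
def Ideal.GeneratedByRegular {R : Type*} [CommRing R] (I : Ideal R) : Prop :=
  ∃ rs : List R, IsWeaklyRegular R rs ∧ Ideal.ofList rs = I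

/-- Weak regularity does not ask the ideal to be proper, so flatness suffices and faithful flatness
is not needed. -/
theorem Ideal.GeneratedByRegular.map {R S : Type*} [CommRing R] [CommRing S] [Algebra R S]
    [Module.Flat R S] {I : Ideal R} (h : I.GeneratedByRegular) :
    (I.map (algebraMap R S)).GeneratedByRegular := by
  obtain ⟨rs, hrs, rfl⟩ := h
  exact ⟨_, hrs.of_flat, (Ideal.map_ofList _ _).symm⟩

theorem Ideal.GeneratedByRegular.maximalIdeal_of_ringEquiv {R S : Type*} [CommRing R] [CommRing S]
    [IsLocalRing R] [IsLocalRing S] (e : R ≃+* S) (h : (maximalIdeal R).GeneratedByRegular) :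
    (maximalIdeal S).GeneratedByRegular := by
  algebraize [e.toRingHom]
  have : Module.Flat R S := RingHom.Flat.of_bijective e.bijective
  have := h.map (S := S)
  rwa [← map_ringEquiv_maximalIdeal e]

/-- All local rings of `R` have maximal ideals generated by regular sequences. -/
def LocallyGeneratedByRegular (R : Type*) [CommRing R] : Prop :=
  ∀ (p : Ideal R) [p.IsPrime], (maximalIdeal (Localization.AtPrime p)).GeneratedByRegular

namespace LocallyGeneratedByRegular

theorem of_isLocalization {R S : Type*} [CommRing R] [CommRing S] [Algebra R S] (M : Submonoid R)
    [IsLocalization M S] (h : LocallyGeneratedByRegular R) : LocallyGeneratedByRegular S := by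
  intro q _
  have := IsLocalization.isLocalization_isLocalization_atPrime_isLocalization M
    (Localization.AtPrime q) q
  exact (h (q.comap (algebraMap R S))).maximalIdeal_of_ringEquiv
    (IsLocalization.algEquiv (q.comap (algebraMap R S)).primeCompl _
      (Localization.AtPrime q)).toRingEquiv

theorem atPrime_of_map {R S : Type*} [CommRing R] [CommRing S] [Algebra R S] (M : Submonoid R)
    [IsLocalization M S] (p : Ideal R) [p.IsPrime] (disj : Disjoint (M : Set R) (p : Set R))
    [(p.map (algebraMap R S)).IsPrime]
    (h : (maximalIdeal (Localization.AtPrime (p.map (algebraMap R S)))).GeneratedByRegular) :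
    (maximalIdeal (Localization.AtPrime p)).GeneratedByRegular := by
  have : IsLocalization.AtPrime (Localization.AtPrime (p.map (algebraMap R S))) p := by
    convert IsLocalization.isLocalization_isLocalization_atPrime_isLocalization M
      (Localization.AtPrime (p.map (algebraMap R S))) (p.map (algebraMap R S))
    exact (IsLocalization.under_map_of_isPrime_disjoint M _ ‹_› disj).symm
  exact h.maximalIdeal_of_ringEquiv (IsLocalization.algEquiv p.primeCompl
    (Localization.AtPrime (p.map (algebraMap R S))) (Localization.AtPrime p)).toRingEquiv

theorem of_ringEquiv {R S : Type*} [CommRing R] [CommRing S] (e : R ≃+* S)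
    (h : LocallyGeneratedByRegular R) : LocallyGeneratedByRegular S := by
  intro p _
  exact (h (p.comap e)).maximalIdeal_of_ringEquiv <| IsLocalization.ringEquivOfRingEquiv
    (Localization.AtPrime (p.comap e)) (Localization.AtPrime p) e (e.map_primeCompl_comap_eq p)

theorem of_field (k : Type*) [Field k] : LocallyGeneratedByRegular k := by
  intro p _
  obtain rfl := (Ideal.eq_bot_or_top p).resolve_right Ideal.IsPrime.ne_top'
  refine ⟨[], .nil _ _, ?_⟩
  rw [Ideal.ofList_nil, ← Localization.AtPrime.map_eq_maximalIdeal, Ideal.map_bot]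

/-- On local rings the map is flat, and being unramified it extends the maximal ideal to the maximal
ideal, so a generating regular sequence is carried over. -/
theorem of_etale {R S : Type*} [CommRing R] [CommRing S] [Algebra R S] [Algebra.Etale R S]
    (h : LocallyGeneratedByRegular R) : LocallyGeneratedByRegular S := by
  intro q _
  let p := q.under R
  let _ := Localization.AtPrime.algebraOfLiesOver p q
  have : Algebra.EssFiniteType R (Localization.AtPrime q) := .comp R S _
  have : Algebra.EssFiniteType (Localization.AtPrime p) (Localization.AtPrime q) :=
    .of_comp R _ _
  have : Algebra.FormallyUnramified S (Localization.AtPrime q) :=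
    .of_isLocalization q.primeCompl
  have : Algebra.FormallyUnramified R (Localization.AtPrime q) := .comp R S _
  have : Algebra.FormallyUnramified (Localization.AtPrime p) (Localization.AtPrime q) :=
    .of_restrictScalars R _ _
  have : IsLocalHom (algebraMap (Localization.AtPrime p) (Localization.AtPrime q)) := by
    rw [Localization.AtPrime.IsLiesOverAlgebra.algebraMap_eq]
    infer_instance
  rw [← Algebra.FormallyUnramified.map_maximalIdeal (R := Localization.AtPrime p)]
  exact (h p).map

/-- The fibre over the closed point is a polynomial ring over a field, so `p` is `m R[X]` or is
generated over it by one further `y`. Since `m R[X]` is prime and does not contain `y`, appending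
`y` keeps the sequence regular. -/
theorem polynomial_of_comap_eq_maximalIdeal {R : Type*} [CommRing R] [IsLocalRing R]
    (h : (maximalIdeal R).GeneratedByRegular) (p : Ideal R[X]) [p.IsPrime]
    (max : p.comap C = maximalIdeal R) :
    (maximalIdeal (Localization.AtPrime p)).GeneratedByRegular := by
  suffices hp : p.GeneratedByRegular by
    rw [← Localization.AtPrime.map_eq_maximalIdeal]
    exact hp.map
  by_cases eq : p = (maximalIdeal R).map C
  · rw [eq]
    exact h.map
  have : (p.comap C).IsMaximal := by simpa [max] using maximalIdeal.isMaximal R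
  obtain ⟨y, _, hy⟩ := Polynomial.exists_monic_span_sup_map_eq R p this (by simpa [max])
  rw [max] at hy
  obtain ⟨rs, hrs, hrs'⟩ := h
  refine ⟨rs.map (algebraMap R R[X]) ++ [y], ?_, ?_⟩
  · rw [isWeaklyRegular_append_iff]
    refine ⟨hrs.of_flat, ?_⟩
    rw [isWeaklyRegular_singleton_iff, ← Ideal.map_ofList, hrs']
    have hprime : ((maximalIdeal R).map (algebraMap R R[X])).IsPrime :=
      Ideal.isPrime_map_C_of_isPrime
    have hyn : y ∉ (maximalIdeal R).map (algebraMap R R[X]) := fun hmem =>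
      eq (hy.trans (sup_eq_left.mpr ((Ideal.span_singleton_le_iff_mem _).mpr hmem)))
    rw [isSMulRegular_quotient_iff_mem_of_smul_mem]
    intro x hx
    rw [smul_eq_mul, Ideal.mul_top] at hx ⊢
    exact (hprime.mem_or_mem hx).resolve_left hyn
  · rw [Ideal.ofList_append, Ideal.ofList_singleton, ← Ideal.map_ofList, hrs', hy]
    rfl

theorem polynomial {R : Type*} [CommRing R] (h : LocallyGeneratedByRegular R) :
    LocallyGeneratedByRegular R[X] := by
  intro p hp
  let q := p.comap C
  -- Localizing the coefficients at `q` places `p` over a closed point without changing the local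
  -- ring at `p`.
  let S := (Localization.AtPrime q)[X]
  let pc := Submonoid.map Polynomial.C.toMonoidHom q.primeCompl
  let : Algebra R[X] S := algebra R (Localization.AtPrime q)
  have : IsLocalization pc S := Polynomial.isLocalization _ _
  let pS := p.map (algebraMap R[X] S)
  have disj : Disjoint (pc : Set R[X]) (p : Set R[X]) := by
    simpa [pc, q] using! Set.disjoint_image_left.mpr
      (Set.disjoint_compl_left_iff_subset.mpr (fun _ a ↦ a))
  have : pS.IsPrime := IsLocalization.isPrime_of_isPrime_disjoint pc _ _ ‹_› disj
  have eq : pS.comap C = maximalIdeal (Localization.AtPrime q) := by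
    rw [← IsLocalization.map_under q.primeCompl _ (pS.comap C),
      ← IsLocalization.map_under q.primeCompl _ (maximalIdeal (Localization.AtPrime q)),
      IsLocalization.AtPrime.under_maximalIdeal (Localization.AtPrime q) q]
    congr 1
    have hcomm : (C : Localization.AtPrime q →+* S).comp (algebraMap R (Localization.AtPrime q)) =
        (algebraMap R[X] S).comp C := by
      refine RingHom.ext fun r => ?_
      exact (Polynomial.map_C (algebraMap R (Localization.AtPrime q))).symm
    rw [Ideal.under_def, Ideal.comap_comap, hcomm, ← Ideal.comap_comap,
      ← Ideal.under_def R[X], IsLocalization.under_map_of_isPrime_disjoint pc _ ‹_› disj]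
  exact atPrime_of_map pc p disj (polynomial_of_comap_eq_maximalIdeal (h q) pS eq)

theorem mvPolynomial {R : Type*} [CommRing R] (h : LocallyGeneratedByRegular R) (n : ℕ) :
    LocallyGeneratedByRegular (MvPolynomial (Fin n) R) := by
  induction n with
  | zero => exact h.of_ringEquiv (MvPolynomial.isEmptyRingEquiv R _).symm
  | succ n ih => exact ih.polynomial.of_ringEquiv (MvPolynomial.finSuccEquiv R n).symm.toRingEquiv

theorem of_smooth (k : Type*) {S : Type*} [Field k] [CommRing S] [Algebra k S]
    [Algebra.Smooth k S] : LocallyGeneratedByRegular S := by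
  intro p _
  have : Algebra.IsSmoothAt k p := inferInstance
  obtain ⟨f, hf, hstd⟩ := Algebra.IsSmoothAt.exists_notMem_isStandardSmooth k p
  obtain ⟨n, g, -, hg⟩ := RingHom.IsStandardSmooth.exists_etale_mvPolynomial
    (f := algebraMap k (Localization.Away f)) (RingHom.isStandardSmooth_algebraMap.mpr hstd)
  algebraize [g]
  have hS : LocallyGeneratedByRegular (Localization.Away f) :=
    ((of_field k).mvPolynomial n).of_etale
  have disj : Disjoint (Submonoid.powers f : Set S) (p : Set S) := by
    rw [Set.disjoint_left]
    rintro _ ⟨m, rfl⟩ hm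
    exact hf (Ideal.IsPrime.mem_of_pow_mem ‹_› m hm)
  have := IsLocalization.isPrime_of_isPrime_disjoint (Submonoid.powers f) (Localization.Away f)
    p ‹_› disj
  exact atPrime_of_map (Submonoid.powers f) p disj (hS _)

end LocallyGeneratedByRegular

end RegularSequences

/-! ### Division of 2-forms by a 1-form with reduced singular scheme of codimension two -/

section Division

open IsLocalRing RingTheory.Sequence

theorem Ideal.GeneratedByRegular.exists_regular_pair {B : Type*} [CommRing B] [IsNoetherianRing B]
    {I : Ideal B} (hI : I.GeneratedByRegular) (htop : I ≠ ⊤) (h2 : 2 ≤ I.height) :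
    ∃ x ∈ I, ∃ y ∈ I, (∀ r, x * r = 0 → r = 0) ∧ (∀ r s, y * r = x * s → ∃ t, r = x * t) ∧
      (I = Ideal.span {x, y} ∨
        ∃ z ∈ I, ∀ r s t, z * r = x * s + y * t → ∃ s t, r = x * s + y * t) := by
  classical
  obtain ⟨rs, hrs, rfl⟩ := hI
  -- Krull's height theorem: the height is at most the number of generators.
  have hlen : 2 ≤ rs.length := by
    have h := h2.trans (Ideal.height_le_spanFinrank _ htop)
    have h' : (Ideal.ofList rs).spanFinrank ≤ rs.length := by
      refine (Submodule.spanFinrank_span_le_ncard_of_finite rs.finite_toSet).trans ?_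
      rw [← List.coe_toFinset, Set.ncard_coe_finset]
      exact rs.toFinset_card_le
    exact (by exact_mod_cast h : 2 ≤ (Ideal.ofList rs).spanFinrank).trans h'
  have hreg : ∀ (i : ℕ) (hi : i < rs.length) (r : B), rs[i] * r ∈ Ideal.ofList (rs.take i) →
      r ∈ Ideal.ofList (rs.take i) := by
    intro i hi r hr
    have h := hrs.regular_mod_prev i hi
    rw [isSMulRegular_quotient_iff_mem_of_smul_mem] at h
    simpa only [smul_eq_mul, Ideal.mul_top] using h r (by simpa only [smul_eq_mul, Ideal.mul_top])
  obtain _ | ⟨x, _ | ⟨y, rs⟩⟩ := rs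
  · simp at hlen
  · simp at hlen
  refine ⟨x, Ideal.subset_span (by simp), y, Ideal.subset_span (by simp), fun r hr => ?_,
    fun r s hrs => ?_, ?_⟩
  · simpa using hreg 0 (by simp) r (by simp [hr])
  · simpa [Ideal.mem_span_singleton, Dvd.dvd] using
      hreg 1 (by simp) r (by simp [Ideal.mem_span_singleton, hrs])
  · have hpair : Ideal.ofList [x, y] = Ideal.span {x, y} := by
      rw [Ideal.ofList_cons, Ideal.ofList_singleton, Ideal.span_insert]
    obtain _ | ⟨z, rs⟩ := rs
    · exact .inl hpair
    · refine .inr ⟨z, Ideal.subset_span (by simp), fun r s t hr => ?_⟩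
      have h := hreg 2 (by simp) r
      simp only [List.take_succ_cons, List.take_zero, hpair, List.getElem_cons_succ,
        List.getElem_cons_zero, Ideal.mem_span_pair] at h
      obtain ⟨s, t, hst⟩ := h ⟨s, t, by rw [hr]; ring⟩
      exact ⟨s, t, by rw [← hst]; ring⟩

/-- Two generators bound the height of the maximal ideal by two, so it is the only prime containing
`J`; a radical ideal is the intersection of the primes containing it. -/
theorem IsLocalRing.eq_maximalIdeal_of_isRadical {B : Type*} [CommRing B] [IsNoetherianRing B]
    [IsLocalRing B] {J : Ideal B} (hJ : J.IsRadical) (hle : J ≤ maximalIdeal B)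
    (h2 : 2 ≤ J.height) {x y : B} (hxy : maximalIdeal B = Ideal.span {x, y}) :
    J = maximalIdeal B := by
  classical
  refine le_antisymm hle ?_
  have hm : (maximalIdeal B).height ≤ 2 := by
    refine (Ideal.height_le_spanFinrank _ Ideal.IsPrime.ne_top').trans ?_
    rw [hxy]
    have := (Submodule.spanFinrank_span_le_ncard_of_finite (R := B) (Set.toFinite {x, y})).trans
      (Set.ncard_insert_le x {y})
    rw [Set.ncard_singleton] at this
    exact_mod_cast this
  rw [← hJ.radical, Ideal.radical_eq_sInf]
  refine le_sInf fun Q ⟨hJQ, hQ⟩ => ?_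
  by_contra hcon
  have hlt : Q < maximalIdeal B := lt_of_le_of_ne (le_maximalIdeal hQ.ne_top) fun h => hcon h.ge
  have h := (Ideal.height_add_one_le_of_lt_of_isPrime hlt).trans hm
  have h3 : (2 : ℕ∞) + 1 ≤ 2 := (add_le_add_left (h2.trans (Ideal.height_mono hJQ)) 1).trans h
  exact absurd h3 (by decide)

/-! ### Exactness of `a ∧ -` over a local ring, given solvability after multiplication by the
maximal ideal -/

section Local

variable {B : Type*} [CommRing B] [IsLocalRing B] {ι : Type*} {a : ι → B}

theorem exists_isUnit_or_span_le_maximalIdeal (a : ι → B) :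
    (∃ i, IsUnit (a i)) ∨ Ideal.span (Set.range a) ≤ maximalIdeal B := by
  by_cases h : ∃ i, IsUnit (a i)
  · exact .inl h
  · refine .inr (Ideal.span_le.mpr ?_)
    rintro _ ⟨i, rfl⟩
    exact fun hi => h ⟨i, hi⟩

variable [IsNoetherianRing B] (hm : (maximalIdeal B).GeneratedByRegular)
  (hJ : 2 ≤ (Ideal.span (Set.range a)).height)
include hm hJ

theorem IsLocalRing.eq_zero_of_forall_mul_eq_zero {c : B} (hc : ∀ i, c * a i = 0)
    (h : ∀ r ∈ maximalIdeal B, r * c = 0) : c = 0 := by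
  obtain ⟨i, hi⟩ | hle := exists_isUnit_or_span_le_maximalIdeal a
  · exact (hi.mul_left_eq_zero).mp (hc i)
  · obtain ⟨x, hx, -, -, hreg, -⟩ :=
      hm.exists_regular_pair Ideal.IsPrime.ne_top' (hJ.trans (Ideal.height_mono hle))
    exact hreg c (h x hx)

theorem IsLocalRing.exists_eq_mul_of_wedge_eq_zero (h0 : ∀ c, (∀ i, c * a i = 0) → c = 0)
    {η : ι → B} (hη : ∀ i j, a i * η j - a j * η i = 0)
    (h : ∀ r ∈ maximalIdeal B, ∃ c, ∀ i, r * η i = c * a i) : ∃ c, ∀ i, η i = c * a i := by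
  obtain ⟨i, hi⟩ | hle := exists_isUnit_or_span_le_maximalIdeal a
  · obtain ⟨u, hu⟩ := hi.exists_left_inv
    exact ⟨u * η i, fun j => by linear_combination u * hη i j - η j * hu⟩
  · obtain ⟨x, hx, y, hy, hregx, hregy, -⟩ :=
      hm.exists_regular_pair Ideal.IsPrime.ne_top' (hJ.trans (Ideal.height_mono hle))
    obtain ⟨c, hc⟩ := h x hx
    obtain ⟨c', hc'⟩ := h y hy
    -- Both `y c` and `x c'` are the coefficient of `x y η` along `a`; as `a` has no annihilator
    -- they agree, so `x` divides `c`.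
    obtain ⟨t, ht⟩ := hregy c c' (sub_eq_zero.mp (h0 _ fun i => by
      linear_combination x * hc' i - y * hc i))
    refine ⟨t, fun i => sub_eq_zero.mp (hregx _ ?_)⟩
    linear_combination hc i + a i * ht

theorem IsLocalRing.exists_eq_wedge [Fintype ι] (hrad : (Ideal.span (Set.range a)).IsRadical)
    (h0 : ∀ c, (∀ i, c * a i = 0) → c = 0)
    (h1 : ∀ η : ι → B, (∀ i j, a i * η j - a j * η i = 0) → ∃ c, ∀ i, η i = c * a i)
    {θ : ι → ι → B} (hθ : ∀ i j, θ i j ∈ Ideal.span (Set.range a))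
    (hcoc : ∀ i j k, a i * θ j k - a j * θ i k + a k * θ i j = 0)
    (h : ∀ r ∈ maximalIdeal B, ∃ η : ι → B, ∀ i j, r * θ i j = a i * η j - a j * η i) :
    ∃ ξ : ι → B, ∀ i j, θ i j = a i * ξ j - a j * ξ i := by
  obtain ⟨i, hi⟩ | hle := exists_isUnit_or_span_le_maximalIdeal a
  · obtain ⟨u, hu⟩ := hi.exists_left_inv
    exact ⟨fun k => u * θ i k, fun j k => by linear_combination u * hcoc i j k - θ j k * hu⟩
  obtain ⟨x, hx, y, hy, hregx, hregy, hxy | ⟨z, hz, hregz⟩⟩ :=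
    hm.exists_regular_pair Ideal.IsPrime.ne_top' (hJ.trans (Ideal.height_mono hle))
  · have heq := eq_maximalIdeal_of_isRadical hrad hle hJ hxy
    rw [← heq] at hx hy
    obtain ⟨c, hc⟩ := Ideal.mem_span_range_iff_exists_fun.mp hx
    obtain ⟨d, hd⟩ := Ideal.mem_span_range_iff_exists_fun.mp hy
    exact exists_wedge_eq_of_regular_of_mem hregx hregy a c d hc hd θ
      (fun i j => by rw [← hxy, ← heq]; exact hθ i j) hcoc
  · choose! η hη using h
    refine exists_wedge_eq_of_regular_of_regular hregx hregy hregz a h0 h1 θ η ?_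
    rintro r (rfl | rfl | rfl) <;> exact hη r ‹_›

end Local

/-! ### Exactness of `a ∧ -` in degrees zero, one and two by localization -/

section Global

variable {A : Type*} [CommRing A] {ι : Type*}

theorem span_range_algebraMap {B : Type*} [CommRing B] [Algebra A B] (a : ι → A) :
    Ideal.span (Set.range fun i => algebraMap A B (a i)) =
      (Ideal.span (Set.range a)).map (algebraMap A B) := by
  rw [Ideal.map_span, ← Set.range_comp]
  rfl

theorem height_span_range_le_of_isLocalization {B : Type*} [CommRing B] [Algebra A B]
    (M : Submonoid A) [IsLocalization M B] (a : ι → A) :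
    (Ideal.span (Set.range a)).height ≤
      (Ideal.span (Set.range fun i => algebraMap A B (a i))).height := by
  rw [span_range_algebraMap]
  exact (Ideal.height_mono Ideal.le_comap_map).trans_eq (IsLocalization.height_under M _)

variable [IsNoetherianRing A] (hA : LocallyGeneratedByRegular A) {a : ι → A}
  (hJ : 2 ≤ (Ideal.span (Set.range a)).height)
include hA hJ

theorem eq_zero_of_forall_mul_eq_zero_of_two_le_height {c : A} (hc : ∀ i, c * a i = 0) :
    c = 0 := by
  -- A system with no unknowns is solvable exactly when its right-hand side vanishes.
  obtain ⟨v, hv⟩ := Matrix.exists_mulVec_eq_of_localization (0 : Matrix Unit Empty A)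
    (fun _ => c) fun P _ s h => ⟨0, fun _ => by
    rw [Matrix.mulVec_zero]
    refine IsLocalRing.eq_zero_of_forall_mul_eq_zero (hA P)
      (hJ.trans (height_span_range_le_of_isLocalization P.primeCompl a)) (fun i => ?_)
      fun r hr => ?_
    · rw [← map_mul, mul_assoc, hc, mul_zero, map_zero]
    · obtain ⟨v, hv⟩ := h r hr
      simpa using hv ()⟩
  simpa using hv ()

theorem exists_eq_mul_of_wedge_eq_zero_of_two_le_height [Finite ι] {η : ι → A}
    (hη : ∀ i j, a i * η j - a j * η i = 0) : ∃ c, ∀ i, η i = c * a i := by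
  obtain ⟨v, hv⟩ := Matrix.exists_mulVec_eq_of_localization (Matrix.of fun i (_ : Unit) => a i)
    η fun P _ s h => by
    have hJ' := hJ.trans (height_span_range_le_of_isLocalization (B := Localization.AtPrime P)
      P.primeCompl a)
    obtain ⟨c, hc⟩ := IsLocalRing.exists_eq_mul_of_wedge_eq_zero (hA P) hJ'
      (fun c hc => eq_zero_of_forall_mul_eq_zero_of_two_le_height
        (hA.of_isLocalization P.primeCompl) hJ' hc)
      (η := fun i => algebraMap A _ (s * η i)) (fun i j => by
        rw [← map_mul, ← map_mul, ← map_sub, ← map_zero (algebraMap A _)]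
        congr 1
        linear_combination s * hη i j) fun r hr => by
      obtain ⟨v, hv⟩ := h r hr
      exact ⟨v (), fun i => by simpa [Matrix.mulVec, dotProduct, mul_comm] using hv i⟩
    exact ⟨fun _ => c, fun i => by simpa [Matrix.mulVec, dotProduct, mul_comm] using hc i⟩
  exact ⟨v (), fun i => by simpa [Matrix.mulVec, dotProduct, mul_comm] using hv i⟩

/-- The matrix of `η ↦ a ∧ η`. -/
def wedgeMatrix {A : Type*} [CommRing A] [DecidableEq ι] (a : ι → A) : Matrix (ι × ι) ι A :=
  Matrix.of fun ij k => a ij.1 * (if ij.2 = k then 1 else 0) - a ij.2 * (if ij.1 = k then 1 else 0)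

omit hA hJ [IsNoetherianRing A] in
theorem wedgeMatrix_mulVec [Fintype ι] [DecidableEq ι] (a η : ι → A) (i j : ι) :
    (wedgeMatrix a).mulVec η (i, j) = a i * η j - a j * η i := by
  simp [wedgeMatrix, Matrix.mulVec, dotProduct, sub_mul, Finset.sum_sub_distrib]

omit hA hJ [IsNoetherianRing A] in
theorem wedgeMatrix_map {B : Type*} [CommRing B] [DecidableEq ι] (f : A →+* B) (a : ι → A) :
    (wedgeMatrix a).map f = wedgeMatrix fun i => f (a i) := by
  ext ⟨i, j⟩ k
  simp [wedgeMatrix, apply_ite f]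

/-- A cocycle for `a ∧ -` in degree two with coefficients in the ideal `J` of coefficients of `a`
is a multiple of `a`, if `J` is radical of height at least two. -/
theorem exists_eq_wedge_of_isRadical [Fintype ι] (hrad : (Ideal.span (Set.range a)).IsRadical)
    {θ : ι → ι → A} (hθ : ∀ i j, θ i j ∈ Ideal.span (Set.range a))
    (hcoc : ∀ i j k, a i * θ j k - a j * θ i k + a k * θ i j = 0) :
    ∃ ξ : ι → A, ∀ i j, θ i j = a i * ξ j - a j * ξ i := by
  classical
  obtain ⟨v, hv⟩ := Matrix.exists_mulVec_eq_of_localization (wedgeMatrix a)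
    (fun ij => θ ij.1 ij.2) fun P _ s h => by
    have hJ' := hJ.trans (height_span_range_le_of_isLocalization (B := Localization.AtPrime P)
      P.primeCompl a)
    have hB := hA.of_isLocalization (S := Localization.AtPrime P) P.primeCompl
    simp only [wedgeMatrix_map] at h ⊢
    obtain ⟨ξ, hξ⟩ := IsLocalRing.exists_eq_wedge (hA P) hJ' (by
        rw [span_range_algebraMap, Ideal.IsRadical,
          ← IsLocalization.map_radical P.primeCompl, hrad.radical])
      -- Exactness in degrees zero and one is needed over `A_P`, which again satisfies the
      -- hypotheses of the global statements.
      (fun c hc => eq_zero_of_forall_mul_eq_zero_of_two_le_height hB hJ' hc)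
      (fun η hη => exists_eq_mul_of_wedge_eq_zero_of_two_le_height hB hJ' hη)
      (θ := fun i j => algebraMap A _ (s * θ i j)) (fun i j => by
        rw [span_range_algebraMap]
        exact Ideal.mem_map_of_mem _ (Ideal.mul_mem_left _ _ (hθ i j))) (fun i j k => by
        rw [← map_mul, ← map_mul, ← map_mul, ← map_sub, ← map_add, ← map_zero (algebraMap A _)]
        congr 1
        linear_combination s * hcoc i j k) fun r hr => by
      obtain ⟨η, hη⟩ := h r hr
      exact ⟨η, fun i j => (hη (i, j)).trans (wedgeMatrix_mulVec _ _ i j)⟩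
    exact ⟨ξ, fun ⟨i, j⟩ => by rw [wedgeMatrix_mulVec]; exact hξ i j⟩
  exact ⟨v, fun i j => by simpa [wedgeMatrix_mulVec] using hv (i, j)⟩

end Global

end Division

/-! ### Coordinates of 2-forms -/

theorem map_mem_of_mem_smul_top {A M : Type*} [CommRing A] [AddCommGroup M] [Module A M]
    (f : M →ₗ[A] A) {J : Ideal A} {x : M} (hx : x ∈ J • (⊤ : Submodule A M)) : f x ∈ J := by
  induction hx using Submodule.smul_induction_on' with
  | smul r hr n _ => rw [map_smul]; exact Ideal.mul_mem_right _ _ hr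
  | add x _ y _ hx hy => rw [map_add]; exact J.add_mem hx hy

namespace KForm

variable {k : Type u} [CommRing k] {A : Type u} [CommRing A] [Algebra k A]

theorem linearMap_ext_wedge {N : Type*} [AddCommGroup N] [Module A N]
    {f g : Omega2 k A →ₗ[A] N} (h : ∀ η η', f (wedge η η') = g (wedge η η')) : f = g := by
  refine exteriorPower.linearMap_ext (AlternatingMap.ext fun v => ?_)
  have hv : v = ![v 0, v 1] := by ext i; fin_cases i <;> rfl
  rw [hv]
  exact h _ _

/-- The value of a 2-form on a pair of linear functionals. -/
noncomputable def pairing (f g : Module.Dual A (Ω[A⁄k])) : Omega2 k A →ₗ[A] A :=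
  exteriorPower.pairingDual A (Ω[A⁄k]) 2 (exteriorPower.ιMulti A 2 ![f, g])

theorem pairing_wedge (f g : Module.Dual A (Ω[A⁄k])) (η η' : Ω[A⁄k]) :
    pairing f g (wedge η η') = f η * g η' - g η * f η' := by
  simp [pairing, wedge_apply, exteriorPower.pairingDual_ιMulti_ιMulti, Matrix.det_fin_two]

/-- The exterior algebra is the Clifford algebra of the zero form, so Clifford contraction gives an
antiderivation for extracting coordinates of forms. -/
theorem contractLeft_contractLeft_coe (f g : Module.Dual A (Ω[A⁄k])) (θ : Omega2 k A) :
    CliffordAlgebra.contractLeft (Q := 0) g (CliffordAlgebra.contractLeft (Q := 0) f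
      (θ : ExteriorAlgebra A (Ω[A⁄k]))) = algebraMap A _ (pairing f g θ) := by
  have h : (CliffordAlgebra.contractLeft (Q := 0) g ∘ₗ CliffordAlgebra.contractLeft (Q := 0) f) ∘ₗ
      (⋀[A]^2 (Ω[A⁄k])).subtype =
      Algebra.linearMap A (ExteriorAlgebra A (Ω[A⁄k])) ∘ₗ pairing f g := by
    refine linearMap_ext_wedge fun η η' => ?_
    have h1 : CliffordAlgebra.contractLeft (Q := 0) f
        (ExteriorAlgebra.ι A η * ExteriorAlgebra.ι A η') =
        f η • ExteriorAlgebra.ι A η' - f η' • ExteriorAlgebra.ι A η := by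
      refine (CliffordAlgebra.contractLeft_ι_mul f η _).trans ?_
      congr 1
      rw [Algebra.smul_def, Algebra.commutes]
      exact congrArg _ (CliffordAlgebra.contractLeft_ι (Q := 0) f η')
    have h2 : ∀ ζ, CliffordAlgebra.contractLeft (Q := 0) g (ExteriorAlgebra.ι A ζ) =
        algebraMap A _ (g ζ) := fun ζ => CliffordAlgebra.contractLeft_ι (Q := 0) g ζ
    simp only [LinearMap.comp_apply, Submodule.subtype_apply, wedge_coe, h1, map_sub, map_smul, h2,
      Algebra.linearMap_apply, pairing_wedge, map_mul]
    simp only [Algebra.smul_def]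
    exact congrArg _ (Algebra.commutes _ _)
  exact LinearMap.congr_fun h θ

/-- Contracting `ω ∧ θ = 0` successively with `e`, `f`, `g` leaves a scalar, and scalars embed in
the exterior algebra. -/
theorem cocycle_of_ι_mul_eq_zero {ω : Ω[A⁄k]} {θ : Omega2 k A}
    (h : ExteriorAlgebra.ι A ω * (θ : ExteriorAlgebra A (Ω[A⁄k])) = 0)
    (e f g : Module.Dual A (Ω[A⁄k])) :
    e ω * pairing f g θ - f ω * pairing e g θ + g ω * pairing e f θ = 0 := by
  have hι : ∀ (d : Module.Dual A (Ω[A⁄k])) (x : ExteriorAlgebra A (Ω[A⁄k])),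
      CliffordAlgebra.contractLeft (Q := 0) d (ExteriorAlgebra.ι A ω * x) =
      d ω • x - ExteriorAlgebra.ι A ω * CliffordAlgebra.contractLeft (Q := 0) d x := fun d x =>
    CliffordAlgebra.contractLeft_ι_mul (Q := 0) d ω x
  have h' := congrArg (fun x => CliffordAlgebra.contractLeft (Q := 0) g
    (CliffordAlgebra.contractLeft (Q := 0) f (CliffordAlgebra.contractLeft (Q := 0) e x))) h
  simp only [hι, map_sub, map_smul, map_zero, contractLeft_contractLeft_coe] at h'
  rw [CliffordAlgebra.contractLeft_algebraMap, mul_zero, sub_zero] at h'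
  simp only [Algebra.smul_def, ← map_mul, ← map_sub] at h'
  have h3 := congrArg ExteriorAlgebra.algebraMapInv h'
  rw [ExteriorAlgebra.algebraMap_leftInverse, map_zero] at h3
  linear_combination h3

/-- The sum runs over all ordered pairs and so counts each basis 2-form twice; this avoids ordering
the index set, at the price of later inverting 2. -/
theorem two_smul_eq_sum_pairing {ι : Type*} [Fintype ι] (b : Module.Basis ι A (Ω[A⁄k]))
    (θ : Omega2 k A) :
    (2 : A) • θ = ∑ i, ∑ j, pairing (b.coord i) (b.coord j) θ • wedge (b i) (b j) := by
  have h : (2 : A) • (LinearMap.id : Omega2 k A →ₗ[A] Omega2 k A) =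
      ∑ i, ∑ j, (pairing (b.coord i) (b.coord j)).smulRight (wedge (b i) (b j)) := by
    refine linearMap_ext_wedge fun η η' => ?_
    have hexp : ∀ η η' : Ω[A⁄k],
        ∑ i, ∑ j, (b.repr η i * b.repr η' j) • wedge (b i) (b j) = wedge η η' := by
      intro η η'
      have hl : ∀ (s : Finset ι) (x : ι → Ω[A⁄k]) (y : Ω[A⁄k]),
          wedge (∑ i ∈ s, x i) y = ∑ i ∈ s, wedge (x i) y := by
        intro s x y
        rw [wedge_swap, map_sum, ← Finset.sum_neg_distrib]
        exact Finset.sum_congr rfl fun i _ => (wedge_swap _ _).symm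
      conv_rhs => rw [← b.sum_repr η, ← b.sum_repr η', hl]
      simp only [map_sum, map_smul, wedge_smul_left, smul_smul, mul_comm]
    simp only [LinearMap.smul_apply, LinearMap.id_apply, LinearMap.sum_apply,
      LinearMap.smulRight_apply, pairing_wedge, sub_smul, Finset.sum_sub_distrib,
      Module.Basis.coord_apply]
    rw [hexp, Finset.sum_congr rfl fun i _ => Finset.sum_congr rfl fun j _ => by
        rw [wedge_swap (b i), smul_neg, mul_comm], Finset.sum_comm]
    simp only [Finset.sum_neg_distrib, mul_comm (b.repr η' _)]
    rw [hexp, sub_neg_eq_add, two_smul]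
  simpa using LinearMap.congr_fun h θ

theorem eq_of_pairing_eq {ι : Type*} [Fintype ι] (h2 : IsUnit (2 : A))
    (b : Module.Basis ι A (Ω[A⁄k])) {θ θ' : Omega2 k A}
    (h : ∀ i j, pairing (b.coord i) (b.coord j) θ = pairing (b.coord i) (b.coord j) θ') :
    θ = θ' := by
  rw [← h2.smul_left_cancel, two_smul_eq_sum_pairing b, two_smul_eq_sum_pairing b]
  simp only [h]

theorem coeffIdeal_eq_span {ι : Type*} [Finite ι] (b : Module.Basis ι A (Ω[A⁄k])) (ω : Ω[A⁄k]) :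
    coeffIdeal ω = Ideal.span (Set.range fun i => b.coord i ω) := by
  cases nonempty_fintype ι
  apply le_antisymm
  · rintro _ ⟨φ, rfl⟩
    have h : φ ω = ∑ i, φ (b.repr ω i • b i) := by rw [← map_sum, b.sum_repr]
    rw [Module.Dual.eval_apply, h]
    refine Ideal.sum_mem _ fun i _ => ?_
    rw [map_smul, smul_eq_mul]
    exact Ideal.mul_mem_right _ _ (Ideal.subset_span ⟨i, rfl⟩)
  · rw [Ideal.span_le]
    rintro _ ⟨i, rfl⟩
    exact ⟨b.coord i, rfl⟩

/-- A 2-form `θ ∈ J Ω²` with `ω ∧ θ = 0` is a multiple of `ω`, if the coefficient ideal `J` of `ω`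
is radical of height at least two. -/
theorem exists_eq_wedge_of_isRadical [IsNoetherianRing A] (hA : LocallyGeneratedByRegular A)
    [Module.Free A (Ω[A⁄k])] [Module.Finite A (Ω[A⁄k])] (h2 : IsUnit (2 : A)) {ω : Ω[A⁄k]}
    {θ : Omega2 k A} (hωθ : ExteriorAlgebra.ι A ω * (θ : ExteriorAlgebra A (Ω[A⁄k])) = 0)
    (hheight : 2 ≤ (coeffIdeal ω).height) (hrad : (coeffIdeal ω).IsRadical)
    (hθ : θ ∈ coeffIdeal ω • (⊤ : Submodule A (Omega2 k A))) : ∃ η, θ = wedge ω η := by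
  let b := Module.Free.chooseBasis A (Ω[A⁄k])
  have hJ := coeffIdeal_eq_span b ω
  have hmem : ∀ i j, pairing (b.coord i) (b.coord j) θ ∈ coeffIdeal ω :=
    fun i j => map_mem_of_mem_smul_top _ hθ
  rw [hJ] at hheight hrad hmem
  obtain ⟨ξ, hξ⟩ := _root_.exists_eq_wedge_of_isRadical hA hheight hrad hmem fun i j l =>
    cocycle_of_ι_mul_eq_zero hωθ (b.coord i) (b.coord j) (b.coord l)
  refine ⟨∑ i, ξ i • b i, eq_of_pairing_eq h2 b fun i j => ?_⟩
  rw [hξ, pairing_wedge]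
  have hsum : ∀ i, b.coord i (∑ i, ξ i • b i) = ξ i := fun i => by
    rw [Module.Basis.coord_apply, b.repr_sum_self]
  rw [hsum, hsum]

end KForm

/-! ### Local rings of smooth schemes -/

namespace SchemeForm

variable (k : Type u) [Field k] (X : Scheme.{u}) [X.Over (Spec (.of k))]

variable {X} in
theorem algebraMap_sections_eq (U : X.Opens) :
    algebraMap k Γ(X, U) = ((Scheme.ΓSpecIso (.of k)).inv ≫
      (X ↘ Spec (.of k)).appLE ⊤ U le_top).hom := by
  change ((_ ≫ _) ≫ _ : CommRingCat.of k ⟶ _).hom = _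
  rw [Category.assoc]
  rfl

variable {X} in
theorem smooth_sections [Smooth (X ↘ Spec (.of k))] {U : X.Opens} (hU : IsAffineOpen U) :
    Algebra.Smooth k Γ(X, U) := by
  rw [← RingHom.smooth_algebraMap, algebraMap_sections_eq, CommRingCat.hom_comp]
  refine RingHom.Smooth.comp ?_ ?_
  · exact RingHom.Smooth.holdsForLocalizationAway.of_bijective _ _
      (Scheme.ΓSpecIso (.of k)).symm.commRingCatIsoToRingEquiv.bijective
  · exact Smooth.smooth_appLE (X ↘ Spec (.of k)) (isAffineOpen_top _) hU le_top

/-- The local ring at a point of a smooth scheme is a localization of a smooth algebra. -/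
theorem exists_smooth_isLocalization_stalk [Smooth (X ↘ Spec (.of k))] (x : X) :
    ∃ (S : Type u) (_ : CommRing S) (_ : Algebra k S) (_ : Algebra S (X.presheaf.stalk x))
      (_ : IsScalarTower k S (X.presheaf.stalk x)) (_ : Algebra.Smooth k S) (M : Submonoid S),
      IsLocalization M (X.presheaf.stalk x) := by
  obtain ⟨U, hx⟩ := exists_affineOpens_mem x
  let _ : Algebra Γ(X, U) (X.presheaf.stalk x) := (germHom k U x hx).toRingHom.toAlgebra
  exact ⟨Γ(X, U), inferInstance, inferInstance, inferInstance,
    .of_algebraMap_eq fun r => ((germHom k U x hx).commutes r).symm, smooth_sections k U.2,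
    _, U.2.isLocalization_stalk ⟨x, hx⟩⟩

end SchemeForm

/-! ### Division of `dω` by `ω` at the point `p` -/

theorem theorem2 (k : Type u) [Field k] [CharZero k]
    (X : Scheme.{u}) [X.Over (Spec (.of k))] [Smooth (X ↘ Spec (.of k))]
    (ω : SchemeForm.OneForm k X) (hω : ω.Integrable)
    (p : X) (hp : p ∈ ω.sing)
    (hcodim : 2 ≤ (ω.singIdeal p).height)
    (hrad : (ω.singIdeal p).IsRadical)
    (hd : ω.dGerm p ∈ ω.singIdeal p •
      (⊤ : Submodule (X.presheaf.stalk p) (KForm.Omega2 k (X.presheaf.stalk p)))) :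
    ∃ η : SchemeForm.FormalOneForm k p, ω.formalD p = ω.formalWedge p η := by
  obtain ⟨S, _, _, _, _, _, M, _⟩ := SchemeForm.exists_smooth_isLocalization_stalk k X p
  have : IsNoetherianRing S := Algebra.FiniteType.isNoetherianRing k S
  have : IsNoetherianRing (X.presheaf.stalk p) := IsLocalization.isNoetherianRing M _ ‹_›
  have : Algebra.FormallySmooth S (X.presheaf.stalk p) := .of_isLocalization M
  have : Algebra.FormallySmooth k (X.presheaf.stalk p) := .comp k S _
  have : Algebra.EssFiniteType S (X.presheaf.stalk p) := .of_isLocalization _ M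
  have : Algebra.EssFiniteType k (X.presheaf.stalk p) := .comp k S _
  -- Smoothness makes `Ω¹` projective, hence free over the local ring, so `ω` has coordinates.
  have : Module.Projective (X.presheaf.stalk p) (Ω[X.presheaf.stalk p⁄k]) :=
    Algebra.FormallySmooth.projective_kaehlerDifferential
  have : Module.Free (X.presheaf.stalk p) (Ω[X.presheaf.stalk p⁄k]) :=
    Module.free_of_flat_of_isLocalRing
  have h2 : IsUnit (2 : X.presheaf.stalk p) := by
    rw [← map_ofNat (algebraMap k (X.presheaf.stalk p)) 2]
    exact (IsUnit.mk0 (2 : k) two_ne_zero).map _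
  obtain ⟨η, hη⟩ := KForm.exists_eq_wedge_of_isRadical
    ((LocallyGeneratedByRegular.of_smooth k (S := S)).of_isLocalization M) h2 (hω p) hcodim hrad hd
  -- The formal solution is the image of an algebraic germ.
  refine ⟨AdicCompletion.of _ _ η, ?_⟩
  rw [SchemeForm.OneForm.formalWedge, AdicCompletion.map_of, ← hη]
  rfl
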